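/- Let $n \ge k \ge 3$ be integers and let $m = \lceil (n-k)/2 \rceil$. A family $\mathcal F$ of subsets of $[n]=\{1,\dots,n\}$ contains a copy of $Y_k$ on consecutive levels if it contains $k+1$ distinct sets $F_1, F_2, G_1, \dots, G_{k-1}$ with $G_1 \subset G_2 \subset \cdots \subset G_{k-1} \subset F_1, F_2$ and $|F_1| = |F_2| = |G_{k-1}|+1 = |G_{k-2}|+2 = \cdots = |G_1|+k-1$. It contains a copy of $Y'_k$ on consecutive levels if it contains $k+1$ distinct sets $F_1, F_2, G_1, \dots, G_{k-1}$ with $G_1 \supset G_2 \supset \cdots \supset G_{k-1} \supset F_1, F_2$ and $|F_1| = |F_2| = |G_{k-1}|-1 = |G_{k-2}|-2 = \cdots = |G_1|-(k-1)$. Let $\mathrm{La}_{\mathrm c}(n,Y_k,Y'_k)$ be the largest size of a family of subsets of $[n]$ that contains neither a copy of $Y_k$ nor a copy of $Y'_k$ on consecutive levels, and let $$S(n,k,r) = \sum_{\substack{0\le i\le n\\ i\equiv r \ (\mathrm{mod}\ k)}} \binom{n}{i}.$$ Then $$\mathrm{La}_{\mathrm c}(n,Y_k,Y'_k) = 2^n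 - S(n,k,m).$$ Moreover, the maximum is attained by the family of all subsets of $[n]$ except those whose size is $\equiv m \pmod k$: this family contains no copy of $Y_k$ and no copy of $Y'_k$ on consecutive levels, and its size is $\mathrm{La}_{\mathrm c}(n,Y_k,Y'_k)$. -/

import Mathlib

/-- The family `𝓕` of subsets of `[n]` contains a copy of `Y_k` on consecutive levels:
members `G 1 ⊂ ⋯ ⊂ G (k-1)`, contained in two different members `F₁`, `F₂`, with
`|F₁| = |F₂| = |G (k-1)| + 1 = |G (k-2)| + 2 = ⋯ = |G 1| + (k-1)`.
Only the values `G 1, …, G (k-1)` are used. -/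
def ContainsY {n : ℕ} (k : ℕ) (𝓕 : Finset (Finset (Fin n))) : Prop :=
  ∃ (G : ℕ → Finset (Fin n)) (F₁ F₂ : Finset (Fin n)),
    F₁ ∈ 𝓕 ∧ F₂ ∈ 𝓕 ∧ F₁ ≠ F₂ ∧ F₁.card = F₂.card ∧
    (∀ i ∈ Finset.Icc 1 (k - 1), G i ∈ 𝓕) ∧
    (∀ i ∈ Finset.Ico 1 (k - 1), G i ⊂ G (i + 1)) ∧
    G (k - 1) ⊂ F₁ ∧ G (k - 1) ⊂ F₂ ∧
    (∀ i ∈ Finset.Icc 1 (k - 1), F₁.card = (G i).card + (k - i))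

/-- The family `𝓕` of subsets of `[n]` contains a copy of `Y'_k` (that is, `Y_k` with all
relations reversed) on consecutive levels: members `G 1 ⊃ ⋯ ⊃ G (k-1)`, containing two different
members `F₁`, `F₂`, with
`|F₁| = |F₂| = |G (k-1)| - 1 = |G (k-2)| - 2 = ⋯ = |G 1| - (k-1)`. -/
def ContainsY' {n : ℕ} (k : ℕ) (𝓕 : Finset (Finset (Fin n))) : Prop :=
  ∃ (G : ℕ → Finset (Fin n)) (F₁ F₂ : Finset (Fin n)),
    F₁ ∈ 𝓕 ∧ F₂ ∈ 𝓕 ∧ F₁ ≠ F₂ ∧ F₁.card = F₂.card ∧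
    (∀ i ∈ Finset.Icc 1 (k - 1), G i ∈ 𝓕) ∧
    (∀ i ∈ Finset.Ico 1 (k - 1), G (i + 1) ⊂ G i) ∧
    F₁ ⊂ G (k - 1) ∧ F₂ ⊂ G (k - 1) ∧
    (∀ i ∈ Finset.Icc 1 (k - 1), (G i).card = F₁.card + (k - i))

/-- `𝓕` contains neither a copy of `Y_k` nor a copy of `Y'_k` on consecutive levels. -/
def IsYFree {n : ℕ} (k : ℕ) (𝓕 : Finset (Finset (Fin n))) : Prop :=
  ¬ ContainsY k 𝓕 ∧ ¬ ContainsY' k 𝓕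

open Classical in
/-- `La_c(n, Y_k, Y'_k)`: the largest size of a family of subsets of `[n]` with neither `Y_k` nor
`Y'_k` on consecutive levels (a maximum over a finite collection of families, which includes the
empty family). -/
noncomputable def laC (n k : ℕ) : ℕ :=
  (Finset.univ.filter fun 𝓕 : Finset (Finset (Fin n)) => IsYFree k 𝓕).sup Finset.card

/-- The maximum defining `laC n k` is attained and is an upper bound. -/
theorem laC_isGreatest (n k : ℕ) :
    IsGreatest {N : ℕ | ∃ 𝓕 : Finset (Finset (Fin n)), IsYFree k 𝓕 ∧ 𝓕.card = N} (laC n k) := by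
  classical
  constructor
  · have hne : (Finset.univ.filter
        fun 𝓕 : Finset (Finset (Fin n)) => IsYFree k 𝓕).Nonempty := by
      refine ⟨∅, ?_⟩
      simp [IsYFree, ContainsY, ContainsY']
    obtain ⟨𝓕, h𝓕, h⟩ := Finset.exists_mem_eq_sup _ hne Finset.card
    refine ⟨𝓕, by simpa using h𝓕, ?_⟩
    rw [laC, h]
  · rintro N ⟨𝓕, h𝓕, rfl⟩
    exact Finset.le_sup (f := Finset.card) (by simpa using h𝓕)

/-- The lacunary binomial sum `S(n, k, r)`: the sum of `C(n, i)` over `0 ≤ i ≤ n` with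
`i ≡ r (mod k)`. -/
def lacunarySum (n k r : ℕ) : ℕ :=
  ∑ i ∈ (Finset.range (n + 1)).filter (fun i => i ≡ r [MOD k]), n.choose i

/-- All subsets of `[n]` except those whose size is `≡ r (mod k)`. -/
def trivialFamily (n k r : ℕ) : Finset (Finset (Fin n)) :=
  Finset.univ.filter fun A => ¬ A.card ≡ r [MOD k]

/-! Any `k` consecutive sizes contain one `≡ m (mod k)`, so `trivialFamily n k m` is free. The upper
bound is linear programming duality over maximal chains, that is, orderings of `[n]`. Call `k`
consecutive levels a window. For a free family, a random chain misses `𝓕` at least once on average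
in every window avoiding both `∅` and `[n]` (`factorial_le_sum_missCount`); in each of the two
extreme windows the average can fall short of 1 by at most `1/(n-k+2)`. `exists_window_weights`
gives the windows nonnegative integer weights of total `S(n,k,m)` such that level `l` carries at
most `C(n,l)` and each extreme window at most 1. This is possible because `m` minimises the lacunary
sum (`residueSum_min`). Combining, `|𝓕ᶜ| ≥ S(n,k,m) - 2/(n-k+2)`. For `k < n` the loss is below 1
and integrality finishes; for `k = n` it could equal 1, and `two_le_card_compl` replaces the
argument. -/

/-! ### Lacunary binomial sums. -/

/-- The sum of `C(n, i)` over `0 ≤ i ≤ n` with `i ≡ x (mod k)`, for an integer `x`. -/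
def residueSum (n k : ℕ) (x : ℤ) : ℤ :=
  ∑ i ∈ Finset.range (n + 1), if (k : ℤ) ∣ x - i then (n.choose i : ℤ) else 0

/-- The sum of `C(n, i)` over `0 ≤ i ≤ n` with `i ≡ x (mod k)` and `i ≤ x`. -/
def lowerSum (n k : ℕ) (x : ℤ) : ℤ :=
  ∑ i ∈ Finset.range (n + 1), if (k : ℤ) ∣ x - i ∧ (i : ℤ) ≤ x then (n.choose i : ℤ) else 0

theorem residueSum_eq_lacunarySum (n k r : ℕ) : residueSum n k r = lacunarySum n k r := by
  unfold residueSum lacunarySum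
  push_cast [Finset.sum_filter]
  refine Finset.sum_congr rfl fun i _ => ?_
  simp [Nat.modEq_iff_dvd]

theorem residueSum_congr (n k : ℕ) {x y : ℤ} (h : (k : ℤ) ∣ x - y) :
    residueSum n k x = residueSum n k y := by
  refine Finset.sum_congr rfl fun i _ => ?_
  have : (k : ℤ) ∣ x - i ↔ (k : ℤ) ∣ y - i := by
    rw [← dvd_add_right h (c := y - i)]; ring_nf
  simp only [this]

theorem residueSum_symm (n k : ℕ) (x : ℤ) : residueSum n k (n - x) = residueSum n k x := by
  unfold residueSum
  rw [← Finset.sum_range_reflect]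
  refine Finset.sum_congr rfl fun i hi => ?_
  rw [Finset.mem_range] at hi
  have h1 : n + 1 - 1 - i = n - i := by omega
  rw [h1, Nat.choose_symm (by omega), Nat.cast_sub (by omega)]
  have : (k : ℤ) ∣ n - x - (n - i) ↔ (k : ℤ) ∣ x - i := by
    rw [← dvd_neg]; ring_nf
  simp only [this]

theorem residueSum_succ (n k : ℕ) (x : ℤ) :
    residueSum (n + 1) k x = residueSum n k x + residueSum n k (x - 1) := by
  have h1 : residueSum n k x =
      (∑ i ∈ Finset.range (n + 1),
        if (k : ℤ) ∣ x - (i + 1 : ℕ) then (n.choose (i + 1) : ℤ) else 0) +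
      if (k : ℤ) ∣ x - (0 : ℕ) then 1 else 0 := by
    have := Finset.sum_range_succ'
      (fun i : ℕ => if (k : ℤ) ∣ x - i then (n.choose i : ℤ) else 0) (n + 1)
    rw [Finset.sum_range_succ] at this
    simpa [residueSum] using this
  rw [h1]
  unfold residueSum
  rw [Finset.sum_range_succ', add_right_comm, ← Finset.sum_add_distrib]
  congr 1
  · refine Finset.sum_congr rfl fun i _ => ?_
    have : x - (i + 1 : ℕ) = x - 1 - i := by push_cast; ring
    rw [this, Nat.choose_succ_succ]
    split_ifs
    · push_cast; ring
    · simp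

/-- By Pascal's rule the claim for `n + 1` compares residues `r + 1` and `r - 1` for `n`, which is
two steps of induction. At either end of the range of `r` one step is unavailable, but there the
reflection `i ↦ n - i` and periodicity give equality. -/
theorem residueSum_succ_le {k : ℕ} (hk : 2 ≤ k) (n : ℕ) :
    ∀ r : ℤ, (n : ℤ) ≤ 2 * r + 1 → 2 * r + 1 ≤ n + k →
      residueSum n k (r + 1) ≤ residueSum n k r := by
  induction n with
  | zero =>
    intro r h1 h2
    have : ¬ (k : ℤ) ∣ r + 1 := by
      intro h
      have := Int.le_of_dvd (by omega) h
      omega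
    simp only [residueSum, zero_add, Finset.range_one, Finset.sum_singleton]
    simp only [Nat.cast_zero, sub_zero, this, if_false]
    split_ifs <;> simp
  | succ n ih =>
    intro r h1 h2
    push_cast at h1 h2
    rw [residueSum_succ, residueSum_succ, add_sub_cancel_right]
    suffices residueSum n k (r + 1) ≤ residueSum n k (r - 1) by linarith
    by_cases ha : (n : ℤ) = 2 * r
    · rw [← residueSum_symm n k (r - 1)]
      refine le_of_eq (residueSum_congr n k ?_)
      rw [show r + 1 - ((n : ℤ) - (r - 1)) = 0 by omega]
      exact dvd_zero _
    by_cases hb : 2 * r = n + k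
    · rw [← residueSum_symm n k (r - 1)]
      refine le_of_eq (residueSum_congr n k ?_)
      rw [show r + 1 - ((n : ℤ) - (r - 1)) = k by omega]
    have h3 := ih (r - 1) (by omega) (by omega)
    rw [sub_add_cancel] at h3
    exact (ih r (by omega) (by omega)).trans h3

/-- The sums decrease from the centre `n/2` to `m + k`, which is `(n+k)/2` rounded up; an `l` left
of the centre is reflected. -/
theorem residueSum_min {n k m : ℕ} (hk : 2 ≤ k) (h1 : n ≤ 2 * m + k) (h2 : 2 * m + k ≤ n + 1)
    (l : ℤ) (hl1 : (m : ℤ) ≤ l) (hl2 : l ≤ m + k) : residueSum n k m ≤ residueSum n k l := by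
  have key : ∀ (d : ℕ) (s : ℤ), (n : ℤ) ≤ 2 * s + 1 → s + d = m + k →
      residueSum n k (m + k) ≤ residueSum n k s := by
    intro d
    induction d with
    | zero => intro s _ h; rw [← h]; simp
    | succ d ih =>
      intro s hs h
      push_cast at h
      exact (ih (s + 1) (by omega) (by omega)).trans
        (residueSum_succ_le hk n s hs (by omega))
  have hm : residueSum n k (m + k) = residueSum n k m :=
    residueSum_congr n k (by simp)
  rw [← hm]
  by_cases h : (n : ℤ) ≤ 2 * l + 1
  · exact key (m + k - l).toNat l h (by omega)
  · rw [← residueSum_symm n k l]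
    exact key (m + k - (n - l)).toNat _ (by omega) (by omega)

theorem lowerSum_of_neg (n k : ℕ) {x : ℤ} (hx : x < 0) : lowerSum n k x = 0 := by
  refine Finset.sum_eq_zero fun i _ => ?_
  rw [if_neg]
  omega

theorem lowerSum_natCast {n k : ℕ} (hk : 0 < k) (l : ℕ) :
    lowerSum n k l = lowerSum n k (l - k) + n.choose l := by
  have h : (n.choose l : ℤ) =
      ∑ i ∈ Finset.range (n + 1), if i = l then (n.choose i : ℤ) else 0 := by
    rw [Finset.sum_ite_eq']
    split_ifs with h
    · rfl
    · rw [Nat.choose_eq_zero_of_lt (by simpa using h)]; rfl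
  rw [h, lowerSum, lowerSum, ← Finset.sum_add_distrib]
  refine Finset.sum_congr rfl fun i _ => ?_
  have h1 : (k : ℤ) ∣ (l : ℤ) - k - i ↔ (k : ℤ) ∣ l - i := by
    rw [← dvd_sub_self_right (a := (k : ℤ)) (b := (l : ℤ) - i)]; ring_nf
  simp only [h1]
  by_cases hd : (k : ℤ) ∣ l - i
  · obtain ⟨c, hc⟩ := hd
    rcases lt_trichotomy c 0 with hc0 | rfl | hc0
    · have : (k : ℤ) * c ≤ k * (-1) := by gcongr; omega
      simp only [hc, dvd_mul_right, true_and]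
      rw [if_neg (by omega), if_neg (by omega), if_neg (by omega)]; rfl
    · have : i = l := by omega
      subst this
      simp
      omega
    · have : (k : ℤ) * 1 ≤ k * c := by gcongr; omega
      simp only [hc, dvd_mul_right, true_and]
      rw [if_pos (by omega), if_pos (by omega), if_neg (by omega)]; simp
  · have : i ≠ l := by rintro rfl; simp at hd
    simp [hd, this]

/-- Compare top terms and induct along `lowerSum_natCast`: binomials increase weakly up to
`(n+1)/2`. -/
theorem lowerSum_mono {n k : ℕ} (hk : 0 < k) (x : ℤ) (hx : 2 * x ≤ n + 1) :
    lowerSum n k (x - 1) ≤ lowerSum n k x := by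
  induction h : x.toNat using Nat.strong_induction_on generalizing x with
  | _ N ih =>
    rcases lt_or_ge x 0 with hx0 | hx0
    · rw [lowerSum_of_neg n k hx0, lowerSum_of_neg n k (by omega)]
    · lift x to ℕ using hx0
      rcases x with _ | x
      · rw [lowerSum_of_neg n k (by simp), lowerSum_natCast hk,
          lowerSum_of_neg n k (by simpa using hk)]
        simp
      · have e : (((x + 1 : ℕ) : ℤ) - 1) = (x : ℕ) := by push_cast; ring
        rw [e, lowerSum_natCast hk, lowerSum_natCast hk (x + 1)]
        have h1 := ih (((x + 1 : ℕ) : ℤ) - k).toNat (by omega) (((x + 1 : ℕ) : ℤ) - k)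
          (by omega) rfl
        have e2 : (((x + 1 : ℕ) : ℤ) - k - 1) = (x : ℤ) - k := by push_cast; ring
        rw [e2] at h1
        have h2 : n.choose x ≤ n.choose (x + 1) := by
          have := Nat.choose_le_succ_of_lt_half_left (r := x) (n := n)
          rcases lt_or_ge x (n / 2) with h3 | h3
          · exact this h3
          · have : x = n - (x + 1) := by omega
            conv_lhs => rw [this]
            exact (Nat.choose_symm (by omega)).le
        have : (n.choose x : ℤ) ≤ n.choose (x + 1) := by exact_mod_cast h2
        omega

/-- Terms with `i > x` have `i ≥ x + k`, and reflection turns them into a lower sum. -/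
theorem residueSum_eq_add {n k : ℕ} (hk : 0 < k) (x : ℤ) :
    residueSum n k x = lowerSum n k x + lowerSum n k (n - x - k) := by
  have h : lowerSum n k (n - x - k) = ∑ i ∈ Finset.range (n + 1),
      if (k : ℤ) ∣ x - i ∧ x + k ≤ i then (n.choose i : ℤ) else 0 := by
    unfold lowerSum
    rw [← Finset.sum_range_reflect]
    refine Finset.sum_congr rfl fun i hi => ?_
    rw [Finset.mem_range] at hi
    have h1 : n + 1 - 1 - i = n - i := by omega
    rw [h1, Nat.choose_symm (by omega), Nat.cast_sub (by omega)]
    have : (k : ℤ) ∣ n - x - k - (n - i) ↔ (k : ℤ) ∣ x - i := by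
      rw [← dvd_neg, ← dvd_sub_self_right (a := (k : ℤ))]; ring_nf
    simp only [this]
    congr 2
    simp only [eq_iff_iff]; omega
  rw [h, residueSum, lowerSum, ← Finset.sum_add_distrib]
  refine Finset.sum_congr rfl fun i _ => ?_
  by_cases hd : (k : ℤ) ∣ x - i
  · simp only [hd, true_and, if_true]
    obtain ⟨c, hc⟩ := hd
    by_cases hi : (i : ℤ) ≤ x
    · rw [if_pos hi, if_neg (by omega), add_zero]
    · have : c < 0 := by
        by_contra hc0
        have : 0 ≤ (k : ℤ) * c := mul_nonneg (by omega) (by omega)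
        omega
      have : (k : ℤ) * c ≤ k * (-1) := by gcongr; omega
      rw [if_neg hi, if_pos (by omega), zero_add]
  · simp [hd]

/-! ### Fractional packing of windows into levels. -/

/-- Cumulative window weights: `windowPotential n k m b - windowPotential n k m a` is the total
weight of the windows `{i, …, i + k - 1}` with `a ≤ i < b`. -/
def windowPotential (n k m : ℕ) (a : ℤ) : ℤ :=
  -- Greedy filling from both ends; the two formulas agree at `a = m + 1`.
  if a ≤ m + 1 then lowerSum n k (a - 1)
  else residueSum n k m - lowerSum n k (n - (a + k - 1))

theorem windowPotential_of_lt {n k m : ℕ} (hk : 0 < k) {a : ℤ} (ha : (m : ℤ) < a) :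
    windowPotential n k m a = residueSum n k m - lowerSum n k (n - (a + k - 1)) := by
  unfold windowPotential
  split_ifs with h
  · obtain rfl : a = m + 1 := by omega
    rw [residueSum_eq_add hk]
    ring_nf
  · rfl

theorem windowPotential_mono {n k m : ℕ} (hk : 0 < k) (h1 : n ≤ 2 * m + k)
    (h2 : 2 * m + k ≤ n + 1) : Monotone (windowPotential n k m) := by
  refine monotone_int_of_le_succ fun a => ?_
  rcases le_or_gt a m with h | h
  · rw [windowPotential, windowPotential, if_pos (by omega), if_pos (by omega)]
    simpa using lowerSum_mono (n := n) hk a (by omega)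
  · rw [windowPotential_of_lt hk h, windowPotential_of_lt hk (by omega)]
    have := lowerSum_mono (n := n) hk (n - (a + k - 1)) (by omega)
    rw [show (n : ℤ) - (a + k - 1) - 1 = n - (a + 1 + k - 1) by ring] at this
    linarith

/-- The left side is the load on level `l`, from the windows with `l + 1 - k ≤ a ≤ l`. Levels `l ≤
m` and `l ≥ m + k` are filled exactly; between them the bound amounts to minimality of the residue
`m`. -/
theorem windowPotential_sub_le {n k m : ℕ} (hk : 2 ≤ k) (h1 : n ≤ 2 * m + k)
    (h2 : 2 * m + k ≤ n + 1) {l : ℕ} (hl : l ≤ n) :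
    windowPotential n k m (l + 1) - windowPotential n k m (l + 1 - k) ≤ n.choose l := by
  have hk0 : 0 < k := by omega
  have hL := lowerSum_natCast (n := n) hk0 l
  have hR := lowerSum_natCast (n := n) hk0 (n - l)
  rw [Nat.choose_symm hl, Nat.cast_sub hl] at hR
  rcases le_or_gt l m with h | h
  · rw [windowPotential, windowPotential, if_pos (by omega), if_pos (by omega),
      add_sub_cancel_right, show (l : ℤ) + 1 - k - 1 = l - k by ring]
    linarith
  rw [windowPotential_of_lt hk0 (by omega), show (n : ℤ) - (l + 1 + k - 1) = n - l - k by ring]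
  rcases le_or_gt (m + k) l with h' | h'
  · rw [windowPotential_of_lt hk0 (by omega), show (n : ℤ) - (l + 1 - k + k - 1) = n - l by ring]
    linarith
  · rw [windowPotential, if_pos (by omega), show (l : ℤ) + 1 - k - 1 = l - k by ring]
    have := residueSum_min hk h1 h2 l (by omega) (by omega)
    rw [residueSum_eq_add hk0 l] at this
    linarith

/-- A fractional packing of the windows of `k` consecutive levels into the level sizes, of total
weight `residueSum n k m`. -/
theorem exists_window_weights {n k m : ℕ} (hk : 2 ≤ k) (hkn : k ≤ n) (h1 : n ≤ 2 * m + k)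
    (h2 : 2 * m + k ≤ n + 1) :
    ∃ y : ℕ → ℤ, (∀ a, 0 ≤ y a) ∧ y 0 ≤ 1 ∧ y (n - k + 1) ≤ 1 ∧
      ∑ a ∈ Finset.range (n - k + 2), y a = residueSum n k m ∧
      ∀ c : ℕ → ℤ, (∀ l, 0 ≤ c l) →
        ∑ a ∈ Finset.range (n - k + 2), y a * ∑ i ∈ Finset.range k, c (a + i) ≤
          ∑ l ∈ Finset.range (n + 1), n.choose l * c l := by
  have hk0 : 0 < k := by omega
  have mono := windowPotential_mono hk0 h1 h2
  set Φ := windowPotential n k m with hΦ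
  refine ⟨fun a => Φ (a + 1) - Φ a, fun a => sub_nonneg.2 (mono (by simp)), ?_, ?_, ?_, ?_⟩
  · have := windowPotential_sub_le hk h1 h2 (l := 0) (by omega)
    have h3 : Φ ((0 : ℕ) + 1 - k) ≤ Φ (0 : ℕ) := mono (by push_cast; omega)
    simp only [Nat.choose_zero_right, Nat.cast_one] at this
    linarith
  · have := windowPotential_sub_le hk h1 h2 (l := n) le_rfl
    have h3 : Φ ((n - k + 1 : ℕ) + 1) ≤ Φ (n + 1) := mono (by push_cast; omega)
    have h4 : ((n - k + 1 : ℕ) : ℤ) = n + 1 - k := by omega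
    simp only [Nat.choose_self, Nat.cast_one] at this
    rw [← h4] at this
    linarith
  · have := Finset.sum_range_sub (fun a : ℕ => Φ a) (n - k + 2)
    push_cast at this
    rw [this, hΦ, windowPotential_of_lt hk0 (by omega), windowPotential, if_pos (by omega),
      lowerSum_of_neg n k (by omega), lowerSum_of_neg n k (by omega)]
    simp
  · intro c hc
    calc
      _ = ∑ i ∈ Finset.range k, ∑ a ∈ Finset.range (n - k + 2),
            (Φ (a + 1) - Φ a) * c (a + i) := by
        simp_rw [Finset.mul_sum]
        exact Finset.sum_comm
      -- Reindexing by level `l = a + i` adds only nonnegative terms; the sum over `i` then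
      -- telescopes.
      _ ≤ ∑ i ∈ Finset.range k, ∑ l ∈ Finset.range (n + 1),
            (Φ (l + 1 - i) - Φ (l + 1 - (i + 1 : ℕ))) * c l := by
        refine Finset.sum_le_sum fun i hi => ?_
        rw [Finset.mem_range] at hi
        have e : ∀ a ∈ Finset.range (n - k + 2), (Φ (a + 1) - Φ a) * c (a + i) =
            (fun l : ℕ => (Φ (l + 1 - i) - Φ (l + 1 - (i + 1 : ℕ))) * c l)
              ((addRightEmbedding i) a) := by
          intro a _
          simp only [addRightEmbedding_apply]
          congr 3 <;> push_cast <;> ring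
        rw [Finset.sum_congr rfl e, ← Finset.sum_map (Finset.range (n - k + 2)) (addRightEmbedding i)
          (fun l : ℕ => (Φ (l + 1 - i) - Φ (l + 1 - (i + 1 : ℕ))) * c l)]
        refine Finset.sum_le_sum_of_subset_of_nonneg ?_ fun l _ _ => ?_
        · intro l hl
          simp only [Finset.mem_map, Finset.mem_range, addRightEmbedding_apply] at hl ⊢
          omega
        · exact mul_nonneg (sub_nonneg.2 (mono (by push_cast; omega))) (hc l)
      _ = ∑ l ∈ Finset.range (n + 1), (Φ (l + 1) - Φ (l + 1 - k)) * c l := by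
        rw [Finset.sum_comm]
        refine Finset.sum_congr rfl fun l _ => ?_
        rw [← Finset.sum_mul, Finset.sum_range_sub' (fun i : ℕ => Φ (l + 1 - i)) k]
        simp
      _ ≤ _ := by
        refine Finset.sum_le_sum fun l hl => ?_
        rw [Finset.mem_range] at hl
        exact mul_le_mul_of_nonneg_right (windowPotential_sub_le hk h1 h2 (by omega)) (hc l)

/-! ### Maximal chains and counting missed sets. -/

open Equiv in
/-- The set of the first `l` elements of `[n]` in the order given by `σ`. -/
def chainSet {n : ℕ} (σ : Perm (Fin n)) (l : ℕ) : Finset (Fin n) :=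
  Finset.univ.filter fun x => (σ x : ℕ) < l

theorem mem_chainSet {n l : ℕ} {σ : Equiv.Perm (Fin n)} {x : Fin n} :
    x ∈ chainSet σ l ↔ (σ x : ℕ) < l := by
  simp [chainSet]

theorem card_chainSet {n l : ℕ} (σ : Equiv.Perm (Fin n)) (hl : l ≤ n) :
    (chainSet σ l).card = l := by
  have h : (chainSet σ l).map σ.toEmbedding =
      Finset.univ.filter fun x : Fin n => (x : ℕ) < l := by
    ext x
    simp [chainSet, Finset.mem_map_equiv]
  rw [← Finset.card_map σ.toEmbedding, h, Fin.card_filter_val_lt]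
  omega

theorem chainSet_ssubset {n l l' : ℕ} (σ : Equiv.Perm (Fin n)) (h : l < l') (hl : l' ≤ n) :
    chainSet σ l ⊂ chainSet σ l' := by
  refine (Finset.ssubset_iff_subset_ne).2 ⟨fun x hx => ?_, fun he => ?_⟩
  · rw [mem_chainSet] at hx ⊢
    omega
  · have := congrArg Finset.card he
    rw [card_chainSet σ (by omega), card_chainSet σ hl] at this
    omega

/-- Left multiplication by `g` permutes positions, so it alters the chain only at levels `l` where
`g` does not preserve the first `l` positions. -/
theorem chainSet_mul_eq {n l : ℕ} {g : Equiv.Perm (Fin n)} (σ : Equiv.Perm (Fin n))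
    (hg : ∀ i : Fin n, ((g i : ℕ) < l ↔ (i : ℕ) < l)) : chainSet (g * σ) l = chainSet σ l := by
  ext x
  rw [mem_chainSet, mem_chainSet]
  exact hg (σ x)

theorem chainSet_mul_ne {n l : ℕ} {g : Equiv.Perm (Fin n)} (σ : Equiv.Perm (Fin n)) (i : Fin n)
    (hg : ¬ ((g i : ℕ) < l ↔ (i : ℕ) < l)) : chainSet (g * σ) l ≠ chainSet σ l := by
  intro h
  have := Finset.ext_iff.1 h (σ⁻¹ i)
  rw [mem_chainSet, mem_chainSet] at this
  simp at this
  exact hg this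

theorem card_filter_chainSet_eq {n : ℕ} (A : Finset (Fin n)) :
    n.choose A.card * (Finset.univ.filter fun σ => chainSet σ A.card = A).card = n.factorial := by
  have hA : A.card ≤ n := by simpa using A.card_le_univ
  have h : (Finset.univ.filter fun σ => chainSet σ A.card = A).card =
      (Numbering.prefixed A).card := by
    refine Finset.card_equiv ((Equiv.refl _).equivCongr (finCongr (Fintype.card_fin n).symm)) ?_
    intro σ
    rw [Finset.mem_filter, Numbering.mem_prefixed, Finset.ext_iff]
    simp only [Finset.mem_univ, true_and, mem_chainSet]
    refine forall_congr' fun x => ?_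
    simpa [Equiv.equivCongr] using Iff.comm
  rw [h, Numbering.card_prefixed, Fintype.card_fin, ← mul_assoc,
    Nat.choose_mul_factorial_mul_factorial hA]

/-- The number of orderings of `[n]` whose first `l` elements form a set outside `𝓕`. -/
def missCount {n : ℕ} (𝓕 : Finset (Finset (Fin n))) (l : ℕ) : ℕ :=
  (Finset.univ.filter fun σ => chainSet σ l ∉ 𝓕).card

theorem choose_mul_missCount {n : ℕ} (𝓕 : Finset (Finset (Fin n))) {l : ℕ} (hl : l ≤ n) :
    n.choose l * missCount 𝓕 l = n.factorial * (𝓕ᶜ.filter fun A => A.card = l).card := by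
  have h : missCount 𝓕 l = ∑ A ∈ 𝓕ᶜ.filter (fun A => A.card = l),
      (Finset.univ.filter fun σ => chainSet σ l = A).card := by
    rw [missCount, Finset.card_eq_sum_card_fiberwise (f := fun σ => chainSet σ l)
      (t := 𝓕ᶜ.filter (fun A => A.card = l))]
    · refine Finset.sum_congr rfl fun A hA => ?_
      rw [Finset.filter_filter]
      congr 1
      ext σ
      simp only [Finset.mem_filter, Finset.mem_compl] at hA ⊢
      constructor
      · rintro ⟨h1, h2, h3⟩
        exact ⟨h1, h3⟩
      · rintro ⟨h1, h3⟩
        exact ⟨h1, h3 ▸ hA.1, h3⟩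
    · intro σ hσ
      simp only [Finset.coe_filter, Finset.mem_univ, true_and, Set.mem_ofPred_eq] at hσ
      simp [hσ, card_chainSet σ hl]
  rw [h, Finset.mul_sum, Finset.sum_congr rfl (g := fun _ => n.factorial), Finset.sum_const,
    smul_eq_mul, mul_comm]
  intro A hA
  obtain rfl := (Finset.mem_filter.1 hA).2
  exact card_filter_chainSet_eq A

theorem sum_choose_mul_missCount {n : ℕ} (𝓕 : Finset (Finset (Fin n))) :
    ∑ l ∈ Finset.range (n + 1), n.choose l * missCount 𝓕 l = n.factorial * 𝓕ᶜ.card := by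
  rw [Finset.card_eq_sum_card_fiberwise (f := Finset.card) (t := Finset.range (n + 1)),
    Finset.mul_sum]
  · refine Finset.sum_congr rfl fun l hl => choose_mul_missCount 𝓕 ?_
    simpa [Nat.lt_succ_iff] using hl
  · intro A _
    simpa [Nat.lt_succ_iff] using A.card_le_univ

/-! ### Windows lying entirely in the family. -/

/-- The orderings whose initial segments of sizes `a, …, a + k - 1` all lie in `𝓕`. -/
def fullWindow {n : ℕ} (𝓕 : Finset (Finset (Fin n))) (k a : ℕ) : Finset (Equiv.Perm (Fin n)) :=
  Finset.univ.filter fun σ => ∀ i < k, chainSet σ (a + i) ∈ 𝓕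

theorem mem_fullWindow {n k a : ℕ} {𝓕 : Finset (Finset (Fin n))} {σ : Equiv.Perm (Fin n)} :
    σ ∈ fullWindow 𝓕 k a ↔ ∀ i < k, chainSet σ (a + i) ∈ 𝓕 := by
  simp [fullWindow]

/-- The full window of `σ` supplies the stem and one tip of `Y_k`; the top set of `τ` would be the
second tip. -/
theorem notMem_of_chainSet_top_ne {n k a : ℕ} (hk : 3 ≤ k) {𝓕 : Finset (Finset (Fin n))}
    (h𝓕 : ¬ ContainsY k 𝓕) {σ τ : Equiv.Perm (Fin n)} (ha : a + k ≤ n + 1)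
    (hσ : σ ∈ fullWindow 𝓕 k a) (h1 : chainSet τ (a + (k - 2)) = chainSet σ (a + (k - 2)))
    (h2 : chainSet τ (a + (k - 1)) ≠ chainSet σ (a + (k - 1))) :
    chainSet τ (a + (k - 1)) ∉ 𝓕 := by
  rw [mem_fullWindow] at hσ
  intro hτ
  have e : k - 1 - 1 = k - 2 := by omega
  refine h𝓕 ⟨fun i => chainSet σ (a + (i - 1)), chainSet σ (a + (k - 1)),
    chainSet τ (a + (k - 1)), hσ _ (by omega), hτ, h2.symm, ?_, ?_, ?_, ?_, ?_, ?_⟩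
  · rw [card_chainSet _ (by omega), card_chainSet _ (by omega)]
  · intro i hi
    rw [Finset.mem_Icc] at hi
    exact hσ _ (by omega)
  · intro i hi
    rw [Finset.mem_Ico] at hi
    exact chainSet_ssubset σ (by omega) (by omega)
  · exact chainSet_ssubset σ (by omega) (by omega)
  · dsimp only
    rw [e, ← h1]
    exact chainSet_ssubset τ (by omega) (by omega)
  · intro i hi
    rw [Finset.mem_Icc] at hi
    rw [card_chainSet _ (by omega), card_chainSet _ (by omega)]
    omega

theorem notMem_of_chainSet_bot_ne {n k a : ℕ} (hk : 3 ≤ k) {𝓕 : Finset (Finset (Fin n))}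
    (h𝓕 : ¬ ContainsY' k 𝓕) {σ τ : Equiv.Perm (Fin n)} (ha : a + k ≤ n + 1)
    (hσ : σ ∈ fullWindow 𝓕 k a) (h1 : chainSet τ (a + 1) = chainSet σ (a + 1))
    (h2 : chainSet τ a ≠ chainSet σ a) : chainSet τ a ∉ 𝓕 := by
  rw [mem_fullWindow] at hσ
  intro hτ
  have e : k - (k - 1) = 1 := by omega
  refine h𝓕 ⟨fun i => chainSet σ (a + (k - i)), chainSet σ a,
    chainSet τ a, by simpa using hσ 0 (by omega), hτ, h2.symm, ?_, ?_, ?_, ?_, ?_, ?_⟩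
  · rw [card_chainSet _ (by omega), card_chainSet _ (by omega)]
  · intro i hi
    rw [Finset.mem_Icc] at hi
    exact hσ _ (by omega)
  · intro i hi
    rw [Finset.mem_Ico] at hi
    exact chainSet_ssubset σ (by omega) (by omega)
  · exact chainSet_ssubset σ (by omega) (by omega)
  · dsimp only
    rw [e, ← h1]
    exact chainSet_ssubset τ (by omega) (by omega)
  · intro i hi
    rw [Finset.mem_Icc] at hi
    rw [card_chainSet _ (by omega), card_chainSet _ (by omega)]

/-- The number of levels in the window `a, …, a + k - 1` at which the chain of `σ` misses `𝓕`. -/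
def windowMiss {n : ℕ} (𝓕 : Finset (Finset (Fin n))) (k a : ℕ) (σ : Equiv.Perm (Fin n)) : ℕ :=
  ((Finset.range k).filter fun i => chainSet σ (a + i) ∉ 𝓕).card

theorem sum_windowMiss {n : ℕ} (𝓕 : Finset (Finset (Fin n))) (k a : ℕ) :
    ∑ σ, windowMiss 𝓕 k a σ = ∑ i ∈ Finset.range k, missCount 𝓕 (a + i) := by
  simp only [windowMiss, missCount, Finset.card_filter]
  exact Finset.sum_comm

theorem one_le_windowMiss {n k a : ℕ} {𝓕 : Finset (Finset (Fin n))} {σ : Equiv.Perm (Fin n)}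
    (h : σ ∉ fullWindow 𝓕 k a) : 1 ≤ windowMiss 𝓕 k a σ := by
  rw [mem_fullWindow] at h
  push Not at h
  obtain ⟨i, hi, hm⟩ := h
  exact Finset.card_pos.2 ⟨i, by simp [hi, hm]⟩

theorem factorial_le_sum_missCount_add {n : ℕ} (𝓕 : Finset (Finset (Fin n))) (k a : ℕ) :
    n.factorial ≤ ∑ i ∈ Finset.range k, missCount 𝓕 (a + i) + (fullWindow 𝓕 k a).card := by
  rw [← sum_windowMiss]
  have h1 : (fullWindow 𝓕 k a)ᶜ.card ≤ ∑ σ, windowMiss 𝓕 k a σ :=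
    calc
      _ = ∑ σ ∈ (fullWindow 𝓕 k a)ᶜ, 1 := by simp
      _ ≤ ∑ σ ∈ (fullWindow 𝓕 k a)ᶜ, windowMiss 𝓕 k a σ :=
        Finset.sum_le_sum fun σ hσ => one_le_windowMiss (Finset.mem_compl.1 hσ)
      _ ≤ _ := Finset.sum_le_sum_of_subset (Finset.subset_univ _)
  have h2 := Finset.card_add_card_compl (fullWindow 𝓕 k a)
  rw [Fintype.card_perm, Fintype.card_fin] at h2
  omega

/-- Changing a full chain at both the bottom and the top of the window produces a chain missing `𝓕`
at both places. This injection pays for each full chain with a surplus miss. -/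
theorem factorial_le_sum_missCount {n k a : ℕ} (hk : 3 ≤ k) {𝓕 : Finset (Finset (Fin n))}
    (h𝓕 : IsYFree k 𝓕) (ha : 1 ≤ a) (ha' : a + k ≤ n) :
    n.factorial ≤ ∑ i ∈ Finset.range k, missCount 𝓕 (a + i) := by
  -- The two swaps alter the chain only at levels `a` and `a + k - 1`; they are disjoint because `k
  -- ≥ 3`.
  set g : Equiv.Perm (Fin n) :=
    Equiv.swap ⟨a - 1, by omega⟩ ⟨a, by omega⟩ *
      Equiv.swap ⟨a + (k - 2), by omega⟩ ⟨a + (k - 1), by omega⟩ with hg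
  have hval : ∀ i : Fin n, (g i : ℕ) =
      if (i : ℕ) = a - 1 then a else if (i : ℕ) = a then a - 1 else
      if (i : ℕ) = a + (k - 2) then a + (k - 1) else
      if (i : ℕ) = a + (k - 1) then a + (k - 2) else i := by
    intro i
    simp only [hg, Equiv.Perm.mul_apply, Equiv.swap_apply_def, Fin.ext_iff]
    split_ifs <;> simp_all <;> omega
  have htwo : ∀ σ ∈ fullWindow 𝓕 k a, 2 ≤ windowMiss 𝓕 k a (g * σ) := by
    intro σ hσ
    have h1 : chainSet (g * σ) (a + (k - 1)) ∉ 𝓕 := by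
      refine notMem_of_chainSet_top_ne hk h𝓕.1 (by omega) hσ
        (chainSet_mul_eq σ fun i => ?_)
        (chainSet_mul_ne σ ⟨a + (k - 2), by omega⟩ ?_)
      · rw [hval]; split_ifs <;> omega
      · rw [hval]; dsimp only; split_ifs <;> omega
    have h2 : chainSet (g * σ) a ∉ 𝓕 := by
      refine notMem_of_chainSet_bot_ne hk h𝓕.2 (by omega) hσ
        (chainSet_mul_eq σ fun i => ?_)
        (chainSet_mul_ne σ ⟨a, by omega⟩ ?_)
      · rw [hval]; split_ifs <;> omega
      · rw [hval]; dsimp only; split_ifs <;> omega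
    have hsub : {0, k - 1} ⊆
        (Finset.range k).filter fun i => chainSet (g * σ) (a + i) ∉ 𝓕 := by
      intro i hi
      rw [Finset.mem_insert, Finset.mem_singleton] at hi
      rw [Finset.mem_filter, Finset.mem_range]
      rcases hi with rfl | rfl
      · exact ⟨by omega, h2⟩
      · exact ⟨by omega, h1⟩
    have := Finset.card_le_card hsub
    rwa [Finset.card_pair (by omega)] at this
  set D := Finset.univ.filter fun σ => 2 ≤ windowMiss 𝓕 k a σ with hD
  have hle : (fullWindow 𝓕 k a).card ≤ D.card :=
    Finset.card_le_card_of_injOn (g * ·) (fun σ hσ => by simpa [hD] using htwo σ hσ)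
      (mul_right_injective g).injOn
  have hpt : ∀ σ, 1 + (if 2 ≤ windowMiss 𝓕 k a σ then 1 else 0) ≤
      windowMiss 𝓕 k a σ + if σ ∈ fullWindow 𝓕 k a then 1 else 0 := by
    intro σ
    by_cases hσ : σ ∈ fullWindow 𝓕 k a
    · rw [if_pos hσ]; split_ifs <;> omega
    · have := one_le_windowMiss hσ
      rw [if_neg hσ]; split_ifs <;> omega
  have hsum := Finset.sum_le_sum fun σ (_ : σ ∈ Finset.univ) => hpt σ
  rw [Finset.sum_add_distrib, Finset.sum_add_distrib, ← Finset.card_filter, ← Finset.card_filter,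
    sum_windowMiss, Finset.sum_const, smul_eq_mul, mul_one, Finset.card_univ,
    Fintype.card_perm, Fintype.card_fin, Finset.filter_univ_mem, ← hD] at hsum
  omega

/-- The products `swap p q * σ` with `q ∈ T`, `σ ∈ B` are distinct: a coincidence with `q ≠ r` would
relate two members of `B` by a permutation supported on `T` that moves `p`. -/
theorem card_mul_card_le_factorial {n : ℕ} {B : Finset (Equiv.Perm (Fin n))}
    {T : Finset (Fin n)} {p : Fin n} (hp : p ∈ T)
    (hB : ∀ σ ∈ B, ∀ h : Equiv.Perm (Fin n), (∀ i, i ∉ T → h i = i) → h p ≠ p → h * σ ∉ B) :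
    T.card * B.card ≤ n.factorial := by
  have h : (T ×ˢ B).card ≤ (Finset.univ : Finset (Equiv.Perm (Fin n))).card := by
    refine Finset.card_le_card_of_injOn (fun x => Equiv.swap p x.1 * x.2)
      (fun _ _ => Finset.mem_coe.2 (Finset.mem_univ _)) ?_
    rintro ⟨q, σ⟩ hq ⟨r, τ⟩ hr he
    simp only [Finset.coe_product, Set.mem_prod, Finset.mem_coe] at hq hr he
    have hστ : σ = Equiv.swap p q * Equiv.swap p r * τ := by
      rw [mul_assoc, ← he, ← mul_assoc, Equiv.swap_mul_self, one_mul]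
    by_cases hqr : q = r
    · subst hqr
      simpa using he
    · refine absurd hq.2 ?_
      rw [hστ]
      refine hB τ hr.2 _ (fun i hi => ?_) ?_
      · have h1 : i ≠ p := fun h => hi (h ▸ hp)
        have h2 : i ≠ q := fun h => hi (h ▸ hq.1)
        have h3 : i ≠ r := fun h => hi (h ▸ hr.1)
        rw [Equiv.Perm.mul_apply, Equiv.swap_apply_of_ne_of_ne h1 h3,
          Equiv.swap_apply_of_ne_of_ne h1 h2]
      · rw [Equiv.Perm.mul_apply, Equiv.swap_apply_left]
        by_cases hrp : r = p
        · subst hrp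
          rwa [Equiv.swap_apply_left]
        · rwa [Equiv.swap_apply_of_ne_of_ne hrp (Ne.symm hqr)]
  rwa [Finset.card_product, Finset.card_univ, Fintype.card_perm, Fintype.card_fin] at h

/-- Permuting the last `n - k + 2` positions keeps the set at level `k - 2`; moving position `k - 2`
changes the set above it, which `Y_k`-freeness forbids between full chains. -/
theorem mul_card_fullWindow_zero_le {n k : ℕ} (hk : 3 ≤ k) (hkn : k ≤ n)
    {𝓕 : Finset (Finset (Fin n))} (h𝓕 : IsYFree k 𝓕) :
    (n - k + 2) * (fullWindow 𝓕 k 0).card ≤ n.factorial := by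
  have hcard : (Finset.Ici (⟨k - 2, by omega⟩ : Fin n)).card = n - k + 2 := by
    rw [Fin.card_Ici]; dsimp only; omega
  rw [← hcard]
  refine card_mul_card_le_factorial (p := ⟨k - 2, by omega⟩) (by simp) ?_
  intro σ hσ g hg hgp hgσ
  have hfix : ∀ i : Fin n, (i : ℕ) < k - 2 → g i = i := fun i hi => hg i (by
    rw [Finset.mem_Ici, Fin.le_def]; dsimp only; omega)
  have hlt : ∀ i : Fin n, ((g i : ℕ) < k - 2 ↔ (i : ℕ) < k - 2) := by
    intro i
    constructor
    · intro h
      rwa [← g.injective (hfix _ h)]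
    · intro h
      rwa [hfix i h]
  refine notMem_of_chainSet_top_ne hk h𝓕.1 (by omega) hσ (τ := g * σ) ?_ ?_
    (mem_fullWindow.1 hgσ _ (by omega))
  · exact chainSet_mul_eq σ (by simpa using hlt)
  · refine chainSet_mul_ne σ ⟨k - 2, by omega⟩ ?_
    have h1 := hlt ⟨k - 2, by omega⟩
    rw [Ne, Fin.ext_iff] at hgp
    dsimp only at h1 hgp ⊢
    omega

theorem mul_card_fullWindow_last_le {n k : ℕ} (hk : 3 ≤ k) (hkn : k ≤ n)
    {𝓕 : Finset (Finset (Fin n))} (h𝓕 : IsYFree k 𝓕) :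
    (n - k + 2) * (fullWindow 𝓕 k (n - k + 1)).card ≤ n.factorial := by
  have hcard : (Finset.Iic (⟨n - k + 1, by omega⟩ : Fin n)).card = n - k + 2 := by
    rw [Fin.card_Iic]
  rw [← hcard]
  refine card_mul_card_le_factorial (p := ⟨n - k + 1, by omega⟩) (by simp) ?_
  intro σ hσ g hg hgp hgσ
  have hfix : ∀ i : Fin n, ¬ (i : ℕ) < n - k + 1 + 1 → g i = i := fun i hi => hg i (by
    rw [Finset.mem_Iic, Fin.le_def]; dsimp only; omega)
  have hlt : ∀ i : Fin n, ((g i : ℕ) < n - k + 1 + 1 ↔ (i : ℕ) < n - k + 1 + 1) := by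
    intro i
    rw [← not_iff_not]
    constructor
    · intro h
      rwa [← g.injective (hfix _ h)]
    · intro h
      rwa [hfix i h]
  refine notMem_of_chainSet_bot_ne hk h𝓕.2 (by omega) hσ (τ := g * σ) ?_ ?_
    (by simpa using mem_fullWindow.1 hgσ 0 (by omega))
  · exact chainSet_mul_eq σ hlt
  · refine chainSet_mul_ne σ ⟨n - k + 1, by omega⟩ ?_
    have h1 := hlt ⟨n - k + 1, by omega⟩
    rw [Ne, Fin.ext_iff] at hgp
    dsimp only at h1 hgp ⊢
    omega

/-! ### Lower bound for the complement. -/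

theorem residueSum_le_card_compl {n k m : ℕ} (hk : 3 ≤ k) (hkn : k < n) (h1 : n ≤ 2 * m + k)
    (h2 : 2 * m + k ≤ n + 1) {𝓕 : Finset (Finset (Fin n))} (h𝓕 : IsYFree k 𝓕) :
    residueSum n k m ≤ 𝓕ᶜ.card := by
  obtain ⟨y, hy, hy0, hy1, hsum, hc⟩ := exists_window_weights (by omega) hkn.le h1 h2
  have hB0 := mul_card_fullWindow_zero_le hk hkn.le h𝓕
  have hB1 := mul_card_fullWindow_last_le hk hkn.le h𝓕
  set B0 := (fullWindow 𝓕 k 0).card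
  set B1 := (fullWindow 𝓕 k (n - k + 1)).card
  have hB0' : 3 * B0 ≤ n.factorial := le_trans (Nat.mul_le_mul_right _ (by omega)) hB0
  have hB1' : 3 * B1 ≤ n.factorial := le_trans (Nat.mul_le_mul_right _ (by omega)) hB1
  have hpos := n.factorial_pos
  have hM := hc (fun l => missCount 𝓕 l) (fun l => by positivity)
  have hM2 : ∑ l ∈ Finset.range (n + 1), (n.choose l : ℤ) * (missCount 𝓕 l : ℤ) =
      n.factorial * 𝓕ᶜ.card := by
    exact_mod_cast sum_choose_mul_missCount 𝓕
  rw [hM2] at hM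
  -- The deficits `B0` and `B1` enter at most once each because the extreme weights are at most 1.
  have hE : ∀ a ∈ Finset.range (n - k + 2), (n.factorial : ℤ) * y a -
      ((if a = 0 then (B0 : ℤ) else 0) + if a = n - k + 1 then (B1 : ℤ) else 0) ≤
      y a * ∑ i ∈ Finset.range k, (missCount 𝓕 (a + i) : ℤ) := by
    intro a ha
    rw [Finset.mem_range] at ha
    have hya := hy a
    by_cases ha0 : a = 0
    · subst ha0
      have h3 : (n.factorial : ℤ) ≤ ∑ i ∈ Finset.range k, (missCount 𝓕 (0 + i) : ℤ) + B0 := by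
        exact_mod_cast factorial_le_sum_missCount_add 𝓕 k 0
      rw [if_pos rfl, if_neg (by omega)]
      have : (0 : ℤ) ≤ B0 := by positivity
      nlinarith
    by_cases ha1 : a = n - k + 1
    · subst ha1
      have h3 : (n.factorial : ℤ) ≤
          ∑ i ∈ Finset.range k, (missCount 𝓕 (n - k + 1 + i) : ℤ) + B1 := by
        exact_mod_cast factorial_le_sum_missCount_add 𝓕 k (n - k + 1)
      rw [if_neg ha0, if_pos rfl]
      have : (0 : ℤ) ≤ B1 := by positivity
      nlinarith
    · have h3 : (n.factorial : ℤ) ≤ ∑ i ∈ Finset.range k, (missCount 𝓕 (a + i) : ℤ) := by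
        exact_mod_cast factorial_le_sum_missCount hk h𝓕 (a := a) (by omega) (by omega)
      rw [if_neg ha0, if_neg ha1]
      nlinarith
  have hE' := (Finset.sum_le_sum hE).trans hM
  rw [Finset.sum_sub_distrib, ← Finset.mul_sum, hsum, Finset.sum_add_distrib,
    Finset.sum_ite_eq', Finset.sum_ite_eq', if_pos (by simp), if_pos (by simp)] at hE'
  -- Each deficit is at most `n!/3`, as `n - k + 2 ≥ 3`, so the total loss is less than one set.
  have hlt : (B0 : ℤ) + B1 < n.factorial := by omega
  have : (n.factorial : ℤ) * (residueSum n k m - 1) < n.factorial * 𝓕ᶜ.card := by linarith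
  have := lt_of_mul_lt_mul_left this (by positivity)
  omega

theorem le_choose {n j : ℕ} (hj : 0 < j) (hjn : j < n) : n ≤ n.choose j := by
  induction n generalizing j with
  | zero => omega
  | succ n ih =>
    obtain ⟨i, rfl⟩ : ∃ i, j = i + 1 := ⟨j - 1, by omega⟩
    rw [Nat.choose_succ_succ]
    rcases Nat.eq_zero_or_pos i with rfl | hi
    · simp
    · have h1 := ih hi (by omega)
      have h2 : 0 < n.choose (i + 1) := Nat.choose_pos (by omega)
      exact Nat.add_le_add h1 h2

/-- Both windows are extreme here, and each is full for at most half the chains. A missing set at a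
middle level lies on at most a third of the chains, so a single missing set other than `∅` and `[n]`
is not enough for either window, while `∅` and `[n]` each serve only one. -/
theorem two_le_card_compl {n : ℕ} (hn : 3 ≤ n) {𝓕 : Finset (Finset (Fin n))}
    (h𝓕 : IsYFree n 𝓕) : 2 ≤ 𝓕ᶜ.card := by
  have hpos := n.factorial_pos
  have h0 := factorial_le_sum_missCount_add 𝓕 n 0
  have h1 := factorial_le_sum_missCount_add 𝓕 n 1
  have hB0 := mul_card_fullWindow_zero_le hn le_rfl h𝓕
  have hB1 := mul_card_fullWindow_last_le hn le_rfl h𝓕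
  simp only [Nat.sub_self, zero_add] at hB0 hB1
  set q : ℕ → ℕ := fun l => (𝓕ᶜ.filter fun A => A.card = l).card with hq
  have hcard : 𝓕ᶜ.card = ∑ l ∈ Finset.range (n + 1), q l := by
    rw [Finset.card_eq_sum_card_fiberwise (f := Finset.card) (t := Finset.range (n + 1))]
    intro A _
    simpa [Nat.lt_succ_iff] using A.card_le_univ
  obtain ⟨d, rfl⟩ : ∃ d, n = d + 1 := ⟨n - 1, by omega⟩
  have hmid : ∀ l ∈ Finset.range d,
      3 * missCount 𝓕 (l + 1) ≤ (d + 1).factorial * q (l + 1) := by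
    intro l hl
    rw [Finset.mem_range] at hl
    rw [← choose_mul_missCount 𝓕 (by omega)]
    exact Nat.mul_le_mul_right _ (hn.trans (le_choose (by omega) (by omega)))
  have hsum := Finset.sum_le_sum hmid
  rw [← Finset.mul_sum, ← Finset.mul_sum] at hsum
  have hb : missCount 𝓕 0 = (d + 1).factorial * q 0 := by
    rw [← choose_mul_missCount 𝓕 (by omega)]; simp
  have ht : missCount 𝓕 (d + 1) = (d + 1).factorial * q (d + 1) := by
    rw [← choose_mul_missCount 𝓕 (by omega)]; simp
  rw [Finset.sum_range_succ'] at h0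
  rw [Finset.sum_range_succ] at h1
  simp only [zero_add, add_comm 1] at h0 h1
  rw [Finset.sum_range_succ, Finset.sum_range_succ'] at hcard
  set x := ∑ l ∈ Finset.range d, q (l + 1)
  have c0 : (d + 1).factorial * 3 ≤ (d + 1).factorial * (6 * q 0 + 2 * x) := by
    rw [mul_add]; linarith
  have c1 : (d + 1).factorial * 3 ≤ (d + 1).factorial * (6 * q (d + 1) + 2 * x) := by
    rw [mul_add]; linarith
  have c0' := Nat.le_of_mul_le_mul_left c0 hpos
  have c1' := Nat.le_of_mul_le_mul_left c1 hpos
  omega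

/-! ### The extremal family and the conclusion. -/

theorem isYFree_trivialFamily {n k : ℕ} (hk : 1 ≤ k) (r : ℕ) :
    IsYFree k (trivialFamily n k r) := by
  have key : ∀ s : ℕ, ∃ i < k, s + i ≡ r [MOD k] := by
    intro s
    -- This is `r - s` modulo `k`, written without subtraction.
    refine ⟨(r + (k - 1) * s) % k, Nat.mod_lt _ (by omega), ?_⟩
    calc s + (r + (k - 1) * s) % k ≡ s + (r + (k - 1) * s) [MOD k] :=
          (Nat.mod_modEq _ _).add_left s
      _ = r + k * s := by
          obtain ⟨j, rfl⟩ : ∃ j, k = j + 1 := ⟨k - 1, by omega⟩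
          simp only [Nat.add_sub_cancel]; ring
      _ ≡ r [MOD k] := by simp [Nat.ModEq]
  have mem : ∀ A : Finset (Fin n), A ∈ trivialFamily n k r → ¬ A.card ≡ r [MOD k] := by
    intro A hA
    simpa [trivialFamily] using hA
  constructor
  · rintro ⟨G, F₁, F₂, hF, -, -, -, hG, -, -, -, hc⟩
    have h1 : F₁.card ≥ k - 1 := by
      rcases Nat.lt_or_ge 1 k with h | h
      · have := hc 1 (by simp; omega)
        omega
      · omega
    obtain ⟨i, hi, hmod⟩ := key (F₁.card - (k - 1))
    by_cases hik : i = k - 1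
    · refine mem _ hF ?_
      rwa [hik, Nat.sub_add_cancel h1] at hmod
    · have hm : i + 1 ∈ Finset.Icc 1 (k - 1) := by simp; omega
      refine mem _ (hG _ hm) ?_
      have := hc _ hm
      rwa [show (G (i + 1)).card = F₁.card - (k - 1) + i by omega]
  · rintro ⟨G, F₁, F₂, hF, -, -, -, hG, -, -, -, hc⟩
    obtain ⟨i, hi, hmod⟩ := key F₁.card
    by_cases hik : i = 0
    · refine mem _ hF ?_
      rwa [hik] at hmod
    · have hm : k - i ∈ Finset.Icc 1 (k - 1) := by simp; omega
      refine mem _ (hG _ hm) ?_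
      have := hc _ hm
      rwa [this, show k - (k - i) = i by omega]

theorem card_trivialFamily_add (n k r : ℕ) :
    (trivialFamily n k r).card + lacunarySum n k r = 2 ^ n := by
  have h := Finset.card_filter_add_card_filter_not
    (s := (Finset.univ : Finset (Finset (Fin n)))) (fun A => A.card ≡ r [MOD k])
  have h2 : (Finset.univ.filter fun A : Finset (Fin n) => A.card ≡ r [MOD k]).card =
      lacunarySum n k r := by
    rw [Finset.card_eq_sum_card_fiberwise (f := Finset.card)
      (t := (Finset.range (n + 1)).filter (fun i => i ≡ r [MOD k]))]
    · refine Finset.sum_congr rfl fun i hi => ?_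
      rw [Finset.mem_filter] at hi
      have : n.choose i = (Finset.powersetCard i (Finset.univ : Finset (Fin n))).card := by simp
      rw [this, Finset.filter_filter]
      congr 1
      ext A
      simp only [Finset.mem_filter, Finset.mem_univ, true_and, Finset.mem_powersetCard,
        Finset.subset_univ]
      exact ⟨fun h => h.2, fun h => ⟨h ▸ hi.2, h⟩⟩
    · intro A hA
      have := A.card_le_univ
      simp only [Finset.coe_filter, Finset.mem_univ, true_and, Set.mem_ofPred_eq] at hA
      simp only [Fintype.card_fin] at this
      simp [hA, this]
  rw [h2, Finset.card_univ, Fintype.card_finset, Fintype.card_fin, add_comm] at h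
  exact h

theorem theorem1p8 (n k : ℕ) (hk : 3 ≤ k) (hkn : k ≤ n) (m : ℕ)
    (hm : (m : ℤ) = ⌈((n : ℚ) - (k : ℚ)) / 2⌉) :
    (laC n k : ℤ) = 2 ^ n - (lacunarySum n k m : ℤ) ∧
    IsYFree k (trivialFamily n k m) ∧
    (trivialFamily n k m).card = laC n k := by
  have hm' := (Int.ceil_eq_iff).1 hm.symm
  have h1 : n ≤ 2 * m + k := by
    have : (n : ℚ) ≤ 2 * m + k := by
      have := hm'.2
      push_cast at this
      linarith
    exact_mod_cast this
  have h2 : 2 * m + k ≤ n + 1 := by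
    have : (2 * m + k : ℚ) < n + 2 := by
      have := hm'.1
      push_cast at this
      linarith
    have : 2 * m + k < n + 2 := by exact_mod_cast this
    omega
  have hfree := isYFree_trivialFamily (n := n) (k := k) (by omega) m
  have hcard := card_trivialFamily_add n k m
  have hub : ∀ 𝓕 : Finset (Finset (Fin n)), IsYFree k 𝓕 → lacunarySum n k m ≤ 𝓕ᶜ.card := by
    intro 𝓕 h𝓕
    rw [← Int.ofNat_le, ← residueSum_eq_lacunarySum]
    rcases hkn.lt_or_eq with h | rfl
    · exact residueSum_le_card_compl hk h h1 h2 h𝓕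
    -- For `k = n` there are only two windows, of weight at most 1 each, so the lacunary sum is at
    -- most 2.
    · obtain ⟨y, -, hy0, hy1, hsum, -⟩ := exists_window_weights (by omega) hkn h1 h2
      have := two_le_card_compl hk h𝓕
      rw [Nat.sub_self, Finset.sum_range_succ, Finset.sum_range_one] at hsum
      rw [Nat.sub_self] at hy1
      rw [← hsum]
      simp only [zero_add] at hy1 ⊢
      omega
  obtain ⟨⟨𝓕, h𝓕, hmax⟩, hle⟩ := laC_isGreatest n k
  have hge := hle ⟨_, hfree, rfl⟩
  have hc := Finset.card_add_card_compl 𝓕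
  rw [Fintype.card_finset, Fintype.card_fin] at hc
  have hu := hub 𝓕 h𝓕
  have heq : (trivialFamily n k m).card = laC n k := by omega
  refine ⟨?_, hfree, heq⟩
  rw [← heq, ← Nat.cast_two, ← Nat.cast_pow, ← hcard]
  push_cast
  ring
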